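/- Let $\alpha<0$ and, for $n\ge 3$, let $L_{\alpha,n}$ be the laplacian matrix of the cyclic graph with vertices $1,\dots,n$ in which the edge between $1$ and $n$ has weight $\alpha$ and every other edge has weight $1$; that is, $L_{\alpha,n}$ is the real symmetric $n\times n$ matrix with diagonal entries $1+\alpha,2,\dots,2,1+\alpha$, with entries $-1$ at the positions $(k,k+1)$ and $(k+1,k)$, with entries $-\alpha$ at the positions $(1,n)$ and $(n,1)$, and with zeros elsewhere. Let $\lambda_{\alpha,n,1}\le\dots\le\lambda_{\alpha,n,n}$ be its eigenvalues, counted with multiplicity. Put $$\varkappa_\alpha=\frac{\alpha-1}{\alpha},\qquad N_\alpha=\max\{3,\lfloor\varkappa_\alpha\rfloor+1\},\qquad d_{n,j}=\frac{(j-1)\pi}{n},\qquad g(x)=4\sin^2\frac{x}{2},$$ $$\eta_\alpha(x)=2\arctan\Bigl(\varkappa_\alpha\tan\frac{x}{2}\Bigr)-\pi\quad(0\le x<\pi),\qquad \eta_\alpha(\pi)=0,\qquad h_{\alpha,n,j}(x)=nx-(j-1)\pi-\eta_\alpha(x).$$ **Theorem (convergence of Newton's method).** Let $n\ge N_\alpha$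 and let $j$ be even with $4\le j\le n$. Then $\lambda_{\alpha,n,j}\in[0,4]$; let $z_{\alpha,n,j}$ be the unique point of $[0,\pi]$ with $g(z_{\alpha,n,j})=\lambda_{\alpha,n,j}$. Define $y^{(0)}=d_{n,j}$ and $$y^{(m)}=y^{(m-1)}-\frac{h_{\alpha,n,j}(y^{(m-1)})}{h_{\alpha,n,j}'(y^{(m-1)})}\qquad(m\ge1).$$ This sequence is well defined: for every $m\ge0$ the point $y^{(m)}$ belongs to $[d_{n,j-1},d_{n,j}]$, and $h_{\alpha,n,j}$ is differentiable there with $h_{\alpha,n,j}'(y^{(m)})\ne0$. It converges to $z_{\alpha,n,j}$, and the convergence is at least linear: there is $r<1$ with $|y^{(m+1)}-z_{\alpha,n,j}|\le r\,|y^{(m)}-z_{\alpha,n,j}|$ for all $m\ge0$, and $$|y^{(m)}-z_{\alpha,n,j}|\le\frac{\pi}{n}\left(\frac{\varkappa_\alpha^2-1}{\varkappa_\alpha n-1}\right)^m\qquad(m\ge0).$$ Moreover, if $n\ge 2N_\alpha$, then the convergence is quadratic: there is $C$ with $|y^{(m+1)}-z_{\alpha,n,j}|\le C\,|y^{(m)}-z_{\alpha,n,j}|^2$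 for all $m\ge0$, and $$|y^{(m)}-z_{\alpha,n,j}|\le\frac{\pi}{n}\left(\frac{\pi\varkappa_\alpha^2}{2n^2}\right)^{2^m-1}\qquad(m\ge0).$$ -/

import Mathlib

open Set Filter Topology

noncomputable section

namespace CycleLaplacian

/-- The laplacian matrix of the weighted cycle of order `n` (for `n ≥ 3`): the edge joining the
first and the last vertex has weight `α`, all other edges have weight `1`. -/
def lap (α : ℝ) (n : ℕ) : Matrix (Fin n) (Fin n) ℝ :=
  Matrix.of fun i k =>
    if i = k then (if i.val = 0 ∨ i.val + 1 = n then 1 + α else 2)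
    else if i.val + 1 = k.val ∨ k.val + 1 = i.val then -1
    else if (i.val = 0 ∧ k.val + 1 = n) ∨ (k.val = 0 ∧ i.val + 1 = n) then -α
    else 0

/-- The eigenvalues `λ_{α,n,1} ≤ ... ≤ λ_{α,n,n}` of `lap α n`, counted with algebraic
multiplicity: the `j`-th entry (counted from `1`) of the increasingly sorted list of the roots of
the characteristic polynomial. The matrix is real symmetric, so that this list has length `n`. -/
def eigval (α : ℝ) (n j : ℕ) : ℝ :=
  ((lap α n).charpoly.roots.sort (· ≤ ·)).getD (j - 1) 0

/-- The symbol `g(x) = 4 sin²(x/2)`. -/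
def g (x : ℝ) : ℝ := 4 * Real.sin (x / 2) ^ 2

/-- `z_{α,n,j}`, the preimage of the `j`-th eigenvalue under the restriction of `g` to `[0,π]`. -/
def z (α : ℝ) (n j : ℕ) : ℝ := Function.invFunOn g (Icc 0 Real.pi) (eigval α n j)

/-- `ϰ_α = (α - 1) / α`. -/
def kappa (α : ℝ) : ℝ := (α - 1) / α

/-- `N_α = max {3, ⌊ϰ_α⌋ + 1}`. -/
def N (α : ℝ) : ℕ := max 3 (⌊kappa α⌋₊ + 1)

/-- `d_{n,j} = (j - 1) π / n`. -/
def d (n j : ℕ) : ℝ := ((j : ℝ) - 1) * Real.pi / n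

/-- `η_α(x) = 2 arctan (ϰ_α tan (x/2)) - π` on `[0,π]`, with the value `0` at `π`
(where `tan (x/2) = ∞`). -/
def eta (α x : ℝ) : ℝ :=
  if x = Real.pi then 0 else 2 * Real.arctan (kappa α * Real.tan (x / 2)) - Real.pi

/-- `h_{α,n,j}(x) = n x - (j - 1) π - η_α(x)`. It is used on `[d_{n,j-1}, d_{n,j}] ⊆ (0,π)`. -/
def h (α : ℝ) (n j : ℕ) (x : ℝ) : ℝ := n * x - ((j : ℝ) - 1) * Real.pi - eta α x

/-- The sequence of Newton's method for `f` with the initial point `x₀`. -/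
def newton (f : ℝ → ℝ) (x₀ : ℝ) : ℕ → ℝ
  | 0 => x₀
  | m + 1 => newton f x₀ m - f (newton f x₀ m) / deriv f (newton f x₀ m)

/-- The approximation `y_{α,n,j}^{(m)}` of `z_{α,n,j}`: Newton's method for `h_{α,n,j}` with the
initial point `d_{n,j}`. -/
def y (α : ℝ) (n j m : ℕ) : ℝ := newton (h α n j) (d n j) m

end CycleLaplacian

end

/-! Reflecting the path splits the eigenvectors in two families. Symmetric ones, `cos ((t + 1/2) x)`
with `n x ∈ 2πℤ`, agree at the two ends, so `α` drops out. For antisymmetric ones, `sin ((t + 1/2 -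
n/2) x)`, the boundary condition is `tan (n x / 2) = ϰ tan (x / 2)`, which is `h = 0` for even `j`.
With one negative eigenvalue, which exists because `ϰ < n`, this gives `n` distinct roots of the
characteristic polynomial, hence all of them, already in order (`exists_zero_eigval`).

On `(0, π)` the derivative of `η` decreases and lies between `1/ϰ` and `ϰ < n`, so `h` is increasing
and convex. Newton's method started at `d n j`, to the right of the zero, therefore decreases
towards it. The linear rate comes from the bounds on `h'`, the quadratic rate from the Lipschitz
bound `ϰ² / 2` on `η'`. -/

namespace CycleLaplacian

/-! ### Newton's method for an increasing convex function -/

section Newton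

variable {f f' : ℝ → ℝ} {a b : ℝ}

/-- The error of a Newton step, multiplied by the derivative. -/
theorem newton_step_error {y : ℝ} (ha : f a = 0) (hy : f' y ≠ 0) :
    (y - f y / f' y - a) * f' y = f' y * (y - a) - (f y - f a) := by
  rw [ha]
  field_simp
  ring

/-- Convexity: the tangent at `y` lies below the graph. This is what prevents a Newton step from
overshooting the zero `a`. -/
theorem sub_le_deriv_mul_sub {y : ℝ} (hf : ∀ x ∈ Icc a b, HasDerivAt f (f' x) x)
    (hmono : MonotoneOn f' (Icc a b)) (hy : y ∈ Icc a b) :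
    f y - f a ≤ f' y * (y - a) := by
  refine (convex_Icc a y).image_sub_le_mul_sub_of_deriv_le (f := f) ?_ ?_ ?_ a ⟨le_rfl, hy.1⟩ y
    ⟨hy.1, le_rfl⟩ hy.1
  · exact fun x hx => (hf x ⟨hx.1, hx.2.trans hy.2⟩).continuousAt.continuousWithinAt
  · exact fun x hx => (hf x ⟨(interior_subset hx).1,
      (interior_subset hx).2.trans hy.2⟩).differentiableAt.differentiableWithinAt
  · intro x hx
    have hx' := interior_subset hx
    rw [(hf x ⟨hx'.1, hx'.2.trans hy.2⟩).deriv]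
    exact hmono ⟨hx'.1, hx'.2.trans hy.2⟩ hy hx'.2

theorem mul_sub_le_sub {y lo : ℝ} (hf : ∀ x ∈ Icc a b, HasDerivAt f (f' x) x)
    (hlo : ∀ x ∈ Icc a b, lo ≤ f' x) (hy : y ∈ Icc a b) :
    lo * (y - a) ≤ f y - f a := by
  refine (convex_Icc a y).mul_sub_le_image_sub_of_le_deriv (f := f) ?_ ?_ ?_ a ⟨le_rfl, hy.1⟩ y
    ⟨hy.1, le_rfl⟩ hy.1
  · exact fun x hx => (hf x ⟨hx.1, hx.2.trans hy.2⟩).continuousAt.continuousWithinAt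
  · exact fun x hx => (hf x ⟨(interior_subset hx).1,
      (interior_subset hx).2.trans hy.2⟩).differentiableAt.differentiableWithinAt
  · intro x hx
    have hx' := interior_subset hx
    rw [(hf x ⟨hx'.1, hx'.2.trans hy.2⟩).deriv]
    exact hlo x ⟨hx'.1, hx'.2.trans hy.2⟩

theorem deriv_mul_sub_sub_le {y K : ℝ} (hf : ∀ x ∈ Icc a b, HasDerivAt f (f' x) x)
    (hK : ∀ x ∈ Icc a b, ∀ y ∈ Icc a b, x ≤ y → f' y - f' x ≤ K * (y - x))
    (hy : y ∈ Icc a b) :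
    f' y * (y - a) - (f y - f a) ≤ K / 2 * (y - a) ^ 2 := by
  -- This function of `t` vanishes at `y` and is antitone by `hK`, so it is nonnegative at `a`,
  -- which is the claim. No second derivative is needed.
  have hF : ∀ t ∈ Icc a y, HasDerivAt
      (fun t => f y - f t - f' y * (y - t) + K / 2 * (y - t) ^ 2)
      (-f' t + f' y - K * (y - t)) t := by
    intro t ht
    have h1 : HasDerivAt (fun t : ℝ => y - t) (-1) t := by
      simpa using (hasDerivAt_id t).const_sub y
    have h2 := (((hf t ⟨ht.1, ht.2.trans hy.2⟩).const_sub (f y)).sub (h1.const_mul (f' y))).add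
      ((h1.pow 2).const_mul (K / 2))
    refine h2.congr_deriv ?_
    norm_num
    ring
  have h1 : AntitoneOn (fun t => f y - f t - f' y * (y - t) + K / 2 * (y - t) ^ 2)
      (Icc a y) := by
    refine antitoneOn_of_deriv_nonpos (convex_Icc a y) ?_ ?_ ?_
    · exact fun x hx => (hF x hx).continuousAt.continuousWithinAt
    · exact fun x hx => (hF x (interior_subset hx)).differentiableAt.differentiableWithinAt
    · intro x hx
      have hx' := interior_subset hx
      rw [(hF x hx').deriv]
      have := hK x ⟨hx'.1, hx'.2.trans hy.2⟩ y hy hx'.2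
      linarith
  have h2 := h1 ⟨le_rfl, hy.1⟩ ⟨hy.1, le_rfl⟩ hy.1
  simp only [sub_self, mul_zero] at h2
  norm_num at h2
  linarith

/-- A Newton step for an increasing convex function stays on the right of the zero. -/
theorem newton_mem_Icc (hf : ∀ x ∈ Icc a b, HasDerivAt f (f' x) x) (ha : f a = 0) (hab : a ≤ b)
    (hmono : MonotoneOn f' (Icc a b)) (hpos : ∀ x ∈ Icc a b, 0 < f' x) (m : ℕ) :
    newton f b m ∈ Icc a b := by
  induction m with
  | zero => exact ⟨hab, le_rfl⟩
  | succ m ih =>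
    set y := newton f b m with hy
    have hy' : newton f b (m + 1) = y - f y / f' y := by
      rw [newton, ← hy, (hf y ih).deriv]
    have hp := hpos y ih
    have h1 := sub_le_deriv_mul_sub hf hmono ih
    have h2 := newton_step_error ha hp.ne'
    have h3 : 0 ≤ f y - f a := by
      simpa using mul_sub_le_sub (lo := 0) hf (fun x hx => (hpos x hx).le) ih
    rw [hy']
    constructor
    · have : 0 ≤ (y - f y / f' y - a) * f' y := by linarith
      have := nonneg_of_mul_nonneg_left this hp
      linarith
    · rw [ha, sub_zero] at h3
      have := div_nonneg h3 hp.le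
      linarith [ih.2]

/-- Since `f y ≥ lo * (y - a)` and `f' y ≤ hi`, each step removes at least the fraction `lo / hi` of
the error. -/
theorem newton_succ_sub_le_linear {lo hi : ℝ} (hf : ∀ x ∈ Icc a b, HasDerivAt f (f' x) x)
    (ha : f a = 0) (hab : a ≤ b) (hmono : MonotoneOn f' (Icc a b)) (hlo0 : 0 < lo)
    (hlo : ∀ x ∈ Icc a b, lo ≤ f' x) (hhi : ∀ x ∈ Icc a b, f' x ≤ hi) (m : ℕ) :
    newton f b (m + 1) - a ≤ (1 - lo / hi) * (newton f b m - a) := by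
  have ih := newton_mem_Icc hf ha hab hmono (fun x hx => hlo0.trans_le (hlo x hx)) m
  set y := newton f b m with hy
  have hy' : newton f b (m + 1) = y - f y / f' y := by
    rw [newton, ← hy, (hf y ih).deriv]
  have hp : 0 < f' y := hlo0.trans_le (hlo y ih)
  have h1 := mul_sub_le_sub hf hlo ih
  rw [ha, sub_zero] at h1
  rw [hy']
  have h3 : lo / hi * (y - a) ≤ f y / f' y :=
    calc lo / hi * (y - a) ≤ lo / f' y * (y - a) := by
          have := hhi y ih
          have := sub_nonneg.2 ih.1
          gcongr
      _ = lo * (y - a) / f' y := by ring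
      _ ≤ f y / f' y := by gcongr
  linarith

/-- The new error times `f' y` is the first-order Taylor remainder at `y`, hence at most `K / 2`
times the squared error. -/
theorem newton_succ_sub_le_quadratic {lo K : ℝ} (hf : ∀ x ∈ Icc a b, HasDerivAt f (f' x) x)
    (ha : f a = 0) (hab : a ≤ b) (hmono : MonotoneOn f' (Icc a b)) (hlo0 : 0 < lo)
    (hlo : ∀ x ∈ Icc a b, lo ≤ f' x) (hK0 : 0 ≤ K)
    (hK : ∀ x ∈ Icc a b, ∀ y ∈ Icc a b, x ≤ y → f' y - f' x ≤ K * (y - x)) (m : ℕ) :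
    newton f b (m + 1) - a ≤ K / (2 * lo) * (newton f b m - a) ^ 2 := by
  have ih := newton_mem_Icc hf ha hab hmono (fun x hx => hlo0.trans_le (hlo x hx)) m
  set y := newton f b m with hy
  have hy' : newton f b (m + 1) = y - f y / f' y := by
    rw [newton, ← hy, (hf y ih).deriv]
  have hp : 0 < f' y := hlo0.trans_le (hlo y ih)
  have h1 := deriv_mul_sub_sub_le hf hK ih
  rw [← newton_step_error ha hp.ne'] at h1
  rw [hy']
  calc y - f y / f' y - a ≤ K / 2 * (y - a) ^ 2 / f' y := by rwa [le_div_iff₀ hp]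
    _ ≤ K / 2 * (y - a) ^ 2 / lo := by
        have := hlo y ih
        gcongr
    _ = K / (2 * lo) * (y - a) ^ 2 := by field_simp

theorem le_mul_pow_of_succ_le {e : ℕ → ℝ} {E r : ℝ} (h0 : e 0 ≤ E) (hr : 0 ≤ r)
    (h : ∀ m, e (m + 1) ≤ r * e m) (m : ℕ) : e m ≤ E * r ^ m := by
  induction m with
  | zero => simpa using h0
  | succ m ih =>
    calc e (m + 1) ≤ r * e m := h m
      _ ≤ r * (E * r ^ m) := by gcongr
      _ = E * r ^ (m + 1) := by ring

/-- Squaring doubles the exponent of `q`, and the spare factor `M * E ≤ q` adds one: `2 (2^m - 1) +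
1 = 2^(m+1) - 1`. -/
theorem le_mul_pow_two_pow_of_succ_le {e : ℕ → ℝ} {E M q : ℝ} (he : ∀ m, 0 ≤ e m) (h0 : e 0 ≤ E)
    (hM : 0 ≤ M) (hq : M * E ≤ q) (h : ∀ m, e (m + 1) ≤ M * e m ^ 2) (m : ℕ) :
    e m ≤ E * q ^ (2 ^ m - 1) := by
  have hE : 0 ≤ E := (he 0).trans h0
  have hq0 : 0 ≤ q := (mul_nonneg hM hE).trans hq
  induction m with
  | zero => simpa using h0
  | succ m ih =>
    have hexp : 2 ^ (m + 1) - 1 = (2 ^ m - 1) * 2 + 1 := by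
      have := Nat.one_le_two_pow (n := m)
      rw [pow_succ]
      omega
    calc e (m + 1) ≤ M * e m ^ 2 := h m
      _ ≤ M * (E * q ^ (2 ^ m - 1)) ^ 2 := by
          have := he m
          gcongr
      _ = E * (q ^ (2 ^ m - 1)) ^ 2 * (M * E) := by ring
      _ ≤ E * (q ^ (2 ^ m - 1)) ^ 2 * q := by gcongr
      _ = E * q ^ (2 ^ (m + 1) - 1) := by rw [hexp, pow_succ q, pow_mul]; ring

end Newton

end CycleLaplacian

namespace CycleLaplacian

/-! ### The function `η`, its derivative, and the zero of `h` -/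

section Eta

theorem one_lt_kappa {α : ℝ} (hα : α < 0) : 1 < kappa α := by
  rw [kappa, lt_div_iff_of_neg hα]
  linarith

theorem kappa_lt_of_N_le {α : ℝ} {n : ℕ} (hn : N α ≤ n) : kappa α < n := by
  have h1 := Nat.lt_floor_add_one (kappa α)
  have h2 : ((⌊kappa α⌋₊ + 1 : ℕ) : ℝ) ≤ n := by
    exact_mod_cast (le_max_right _ _).trans hn
  push_cast at h2
  linarith

/-- The derivative of `eta`, as a function of `k = kappa α`. -/
noncomputable def etaDeriv (k x : ℝ) : ℝ :=
  k / (Real.cos (x / 2) ^ 2 + k ^ 2 * Real.sin (x / 2) ^ 2)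

/-- The denominator equals `1 + (k² - 1) sin² (x/2)`. -/
theorem one_le_etaDeriv_denom {k : ℝ} (hk : 1 < k) (x : ℝ) :
    1 ≤ Real.cos (x / 2) ^ 2 + k ^ 2 * Real.sin (x / 2) ^ 2 := by
  have hk2 : 0 ≤ k ^ 2 - 1 := by nlinarith
  nlinarith [Real.sin_sq_add_cos_sq (x / 2), mul_nonneg hk2 (sq_nonneg (Real.sin (x / 2)))]

theorem etaDeriv_le {k : ℝ} (hk : 1 < k) (x : ℝ) : etaDeriv k x ≤ k :=
  div_le_self (by linarith) (one_le_etaDeriv_denom hk x)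

theorem one_div_le_etaDeriv {k : ℝ} (hk : 1 < k) (x : ℝ) : 1 / k ≤ etaDeriv k x := by
  have h1 := one_le_etaDeriv_denom hk x
  rw [etaDeriv, div_le_div_iff₀ (by linarith) (by linarith)]
  have hk2 : 0 ≤ k ^ 2 - 1 := by nlinarith
  rw [Real.sin_sq]
  nlinarith [mul_nonneg hk2 (sq_nonneg (Real.cos (x / 2)))]

theorem antitoneOn_etaDeriv {k : ℝ} (hk : 1 < k) :
    AntitoneOn (etaDeriv k) (Icc 0 Real.pi) := by
  intro x hx y hy hxy
  have h1 := one_le_etaDeriv_denom hk x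
  have hs : Real.sin (x / 2) ≤ Real.sin (y / 2) :=
    Real.sin_le_sin_of_le_of_le_pi_div_two (by linarith [hx.1, Real.pi_pos])
      (by linarith [hy.2]) (by linarith)
  have hs0 : 0 ≤ Real.sin (x / 2) :=
    Real.sin_nonneg_of_nonneg_of_le_pi (by linarith [hx.1]) (by linarith [hx.2, Real.pi_pos])
  have hs2 : Real.sin (x / 2) ^ 2 ≤ Real.sin (y / 2) ^ 2 := by gcongr
  unfold etaDeriv
  refine div_le_div_of_nonneg_left (by linarith) (by linarith) ?_
  rw [Real.cos_sq', Real.cos_sq']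
  have hk2 : 0 ≤ k ^ 2 - 1 := by nlinarith
  nlinarith [mul_le_mul_of_nonneg_left hs2 hk2]

theorem hasDerivAt_etaDeriv {k : ℝ} (hk : 1 < k) (x : ℝ) :
    HasDerivAt (etaDeriv k)
      (-(k * (k ^ 2 - 1) * (Real.sin (x / 2) * Real.cos (x / 2))) /
        (Real.cos (x / 2) ^ 2 + k ^ 2 * Real.sin (x / 2) ^ 2) ^ 2) x := by
  have hx : HasDerivAt (fun x : ℝ => x / 2) (1 / 2) x := (hasDerivAt_id x).div_const 2
  have h1 := one_le_etaDeriv_denom hk x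
  have h := (hasDerivAt_const x k).div
    ((hx.cos.pow 2).add ((hx.sin.pow 2).const_mul (k ^ 2))) (by simp; linarith)
  refine h.congr_deriv ?_
  norm_num
  ring

theorem etaDeriv_sub_le {k : ℝ} (hk : 1 < k) {x y : ℝ} (hxy : x ≤ y) :
    etaDeriv k x - etaDeriv k y ≤ k ^ 2 / 2 * (y - x) := by
  have h := convex_univ.mul_sub_le_image_sub_of_le_deriv (f := etaDeriv k) (C := -(k ^ 2 / 2))
    (fun x _ => (hasDerivAt_etaDeriv hk x).continuousAt.continuousWithinAt)
    (fun x _ => (hasDerivAt_etaDeriv hk x).differentiableAt.differentiableWithinAt) ?_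
    x (mem_univ _) y (mem_univ _) hxy
  · linarith
  · intro t _
    rw [(hasDerivAt_etaDeriv hk t).deriv]
    have h1 := one_le_etaDeriv_denom hk t
    set D := Real.cos (t / 2) ^ 2 + k ^ 2 * Real.sin (t / 2) ^ 2 with hD
    rw [le_div_iff₀ (by positivity)]
    -- AM-GM for `cos` and `k sin`. With `D ≤ D²` it bounds the decrease rate by `(k² - 1) / 2`,
    -- slightly better than needed.
    have h2 : 2 * (k * (Real.sin (t / 2) * Real.cos (t / 2))) ≤ D := by
      nlinarith [sq_nonneg (k * Real.sin (t / 2) - Real.cos (t / 2))]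
    have h3 : D ≤ D ^ 2 := by nlinarith
    have h4 : (k ^ 2 - 1) * (2 * (k * (Real.sin (t / 2) * Real.cos (t / 2)))) ≤
        (k ^ 2 - 1) * D ^ 2 := mul_le_mul_of_nonneg_left (h2.trans h3) (by nlinarith)
    nlinarith [sq_nonneg D]

theorem cos_half_pos {x : ℝ} (hx : x ∈ Ioo 0 Real.pi) : 0 < Real.cos (x / 2) :=
  Real.cos_pos_of_mem_Ioo ⟨by linarith [hx.1, Real.pi_pos], by linarith [hx.2]⟩

theorem hasDerivAt_eta {α x : ℝ} (hα : α < 0) (hx : x ∈ Ioo 0 Real.pi) :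
    HasDerivAt (eta α) (etaDeriv (kappa α) x) x := by
  have hc := cos_half_pos hx
  have hd : HasDerivAt (fun x : ℝ => x / 2) (1 / 2) x := (hasDerivAt_id x).div_const 2
  have ht : HasDerivAt (fun x : ℝ => Real.tan (x / 2))
      (1 / Real.cos (x / 2) ^ 2 * (1 / 2)) x :=
    HasDerivAt.comp (h₂ := Real.tan) x (Real.hasDerivAt_tan hc.ne') hd
  have h := (((ht.const_mul (kappa α)).arctan).const_mul 2).sub_const Real.pi
  have h1 := one_le_etaDeriv_denom (one_lt_kappa hα) x
  have h2 : HasDerivAt (fun x => 2 * Real.arctan (kappa α * Real.tan (x / 2)) - Real.pi)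
      (etaDeriv (kappa α) x) x := by
    refine h.congr_deriv ?_
    rw [etaDeriv, Real.tan_eq_sin_div_cos]
    field_simp
  refine h2.congr_of_eventuallyEq ?_
  filter_upwards [Iio_mem_nhds hx.2] with t ht
  rw [eta, if_neg (ne_of_lt ht)]

theorem eta_mem_Ioo {α x : ℝ} (hα : α < 0) (hx : x ∈ Ioo 0 Real.pi) :
    eta α x ∈ Ioo (-Real.pi) 0 := by
  have ht : 0 < Real.tan (x / 2) :=
    Real.tan_pos_of_pos_of_lt_pi_div_two (by linarith [hx.1]) (by linarith [hx.2])
  have hk := one_lt_kappa hα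
  rw [eta, if_neg hx.2.ne]
  constructor
  · have : 0 < Real.arctan (kappa α * Real.tan (x / 2)) := Real.arctan_pos.2 (by positivity)
    linarith
  · linarith [Real.arctan_lt_pi_div_two (kappa α * Real.tan (x / 2))]

theorem hasDerivAt_h {α x : ℝ} (hα : α < 0) (n j : ℕ) (hx : x ∈ Ioo 0 Real.pi) :
    HasDerivAt (h α n j) (n - etaDeriv (kappa α) x) x := by
  have h1 := (((hasDerivAt_id x).const_mul (n : ℝ)).sub_const
    (((j : ℝ) - 1) * Real.pi)).sub (hasDerivAt_eta hα hx)
  exact h1.congr_deriv (by simp)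

/-- As `-π < η < 0`, the values of `h` at the two ends, `-π - η` and `-η`, have opposite signs. The
condition `3 ≤ j` keeps the left end positive. -/
theorem exists_h_eq_zero {α : ℝ} (hα : α < 0) {n j : ℕ} (hj : 3 ≤ j) (hjn : j ≤ n) :
    ∃ x ∈ Ioo (d n (j - 1)) (d n j), h α n j x = 0 := by
  have hn : (0 : ℝ) < n := by exact_mod_cast (by omega : 0 < n)
  have hjr : (3 : ℝ) ≤ j := by exact_mod_cast hj
  have hjnr : (j : ℝ) ≤ n := by exact_mod_cast hjn
  have hcast : ((j - 1 : ℕ) : ℝ) = j - 1 := by push_cast [Nat.cast_sub (by omega : 1 ≤ j)]; ring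
  have hd1 : n * d n j = (j - 1) * Real.pi := by unfold d; field_simp
  have hd0 : n * d n (j - 1) = (j - 2) * Real.pi := by
    unfold d; rw [hcast]; field_simp; ring
  have hpi := Real.pi_pos
  have hlo : 0 < d n (j - 1) := by
    refine pos_of_mul_pos_right (a := (n : ℝ)) ?_ hn.le
    rw [hd0]
    exact mul_pos (by linarith) hpi
  have hlt : d n (j - 1) < d n j := by
    refine lt_of_mul_lt_mul_left (a := (n : ℝ)) ?_ hn.le
    rw [hd0, hd1]
    nlinarith
  have hhi : d n j < Real.pi := by
    refine lt_of_mul_lt_mul_left (a := (n : ℝ)) ?_ hn.le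
    rw [hd1]
    nlinarith
  have hmem : ∀ x ∈ Icc (d n (j - 1)) (d n j), x ∈ Ioo 0 Real.pi :=
    fun x hx => ⟨hlo.trans_le hx.1, hx.2.trans_lt hhi⟩
  have hc : ContinuousOn (h α n j) (Icc (d n (j - 1)) (d n j)) :=
    fun x hx => (hasDerivAt_h hα n j (hmem x hx)).continuousAt.continuousWithinAt
  have h0 : h α n j (d n (j - 1)) < 0 := by
    have := (eta_mem_Ioo hα (hmem _ ⟨le_rfl, hlt.le⟩)).1
    rw [h, hd0]
    linarith
  have h1 : 0 < h α n j (d n j) := by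
    have := (eta_mem_Ioo hα (hmem _ ⟨hlt.le, le_rfl⟩)).2
    rw [h, hd1]
    linarith
  obtain ⟨x, hx, hx0⟩ := intermediate_value_Ioo hlt.le hc ⟨h0, h1⟩
  exact ⟨x, hx, hx0⟩

end Eta

end CycleLaplacian

namespace CycleLaplacian

/-! ### Eigenvectors of the laplacian matrix -/

section Spectrum

/-- A sum of indicators lets each row sum be evaluated term by term. For `n ≥ 3` the corner entries
do not collide with the off-diagonals. -/
theorem lap_apply {α : ℝ} {n : ℕ} (hn : 3 ≤ n) (i k : Fin n) :
    lap α n i k =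
      ((if i = k then (if i.val = 0 ∨ i.val + 1 = n then 1 + α else 2) else 0) +
      (if i.val + 1 = k.val then -1 else 0)) + (if k.val + 1 = i.val then -1 else 0) +
      (if i.val = 0 then (if k.val + 1 = n then -α else 0) else 0) +
      (if i.val + 1 = n then (if k.val = 0 then -α else 0) else 0) := by
  have hi := i.isLt
  have hk := k.isLt
  simp only [lap, Matrix.of_apply, Fin.ext_iff]
  split_ifs <;> first | omega | simp

theorem sum_ite_val_eq {n : ℕ} (f : ℕ → ℝ) (c : ℝ) (m : ℕ) :
    ∑ k : Fin n, (if k.val = m then c else 0) * f k = if m < n then c * f m else 0 := by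
  rw [Fin.sum_univ_eq_sum_range (fun k => (if k = m then c else 0) * f k)]
  simp

/-- The action of the laplacian matrix on a vector. -/
theorem lap_mulVec {α : ℝ} {n : ℕ} (hn : 3 ≤ n) (f : ℝ → ℝ) (i : Fin n) :
    (lap α n).mulVec (fun k => f k) i =
      if i.val = 0 then (1 + α) * f 0 - f 1 - α * f (n - 1)
      else if i.val + 1 = n then (1 + α) * f (n - 1) - f (n - 2) - α * f 0
      else 2 * f i - f (i - 1) - f (i + 1) := by
  obtain ⟨i, hi⟩ := i
  have e1 : ∀ k : Fin n, (⟨i, hi⟩ = k ↔ k.val = i) := fun k => by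
    rw [Fin.ext_iff]; exact eq_comm
  have e2 : ∀ k : Fin n, (i + 1 = k.val ↔ k.val = i + 1) := fun k => eq_comm
  have e4 : ∀ k : Fin n, (k.val + 1 = n ↔ k.val = n - 1) := fun k => by omega
  have hn1 : ((n - 1 : ℕ) : ℝ) = n - 1 := by push_cast [Nat.cast_sub (by omega : 1 ≤ n)]; ring
  simp only [Matrix.mulVec, dotProduct, lap_apply hn, add_mul, Finset.sum_add_distrib, e1, e2]
  simp only [sum_ite_val_eq (fun m : ℕ => f (m : ℝ))]
  by_cases h0 : i = 0
  · subst h0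
    have e5 : 0 + 1 ≠ n := by omega
    simp only [true_or, if_true, e4, sum_ite_val_eq (fun m : ℕ => f (m : ℝ)), if_neg e5,
      Nat.succ_ne_zero, if_false]
    rw [if_pos (by omega), if_pos (by omega), if_pos (by omega), hn1]
    simp
    ring
  · have e3 : ∀ k : Fin n, (k.val + 1 = i ↔ k.val = i - 1) := fun k => by omega
    have hi1 : ((i - 1 : ℕ) : ℝ) = i - 1 := by
      push_cast [Nat.cast_sub (by omega : 1 ≤ i)]; ring
    simp only [if_neg h0, e3, sum_ite_val_eq (fun m : ℕ => f (m : ℝ))]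
    by_cases h1 : i + 1 = n
    · have hi' : (i : ℝ) = n - 1 := by rw [← h1]; push_cast; ring
      simp only [h1, or_true, if_true, sum_ite_val_eq (fun m : ℕ => f (m : ℝ))]
      rw [if_pos hi, if_neg (lt_irrefl _), if_pos (by omega), if_pos (by omega), hi1, hi',
        show (n : ℝ) - 1 - 1 = n - 2 by ring]
      simp
      ring
    · simp only [h0, h1, or_false, if_false]
      rw [if_pos hi, if_pos (by omega), if_pos (by omega), hi1]
      simp
      ring

theorem charpoly_isRoot_of_mulVec {n : ℕ} {A : Matrix (Fin n) (Fin n) ℝ} {v : Fin n → ℝ} {μ : ℝ}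
    (hv : v ≠ 0) (h : A.mulVec v = μ • v) : A.charpoly.IsRoot μ := by
  rw [Polynomial.IsRoot, Matrix.eval_charpoly]
  refine Matrix.exists_mulVec_eq_zero_iff.1 ⟨v, hv, ?_⟩
  rw [Matrix.sub_mulVec, h]
  simp [Matrix.scalar_apply]

theorem g_eq (x : ℝ) : g x = 2 - 2 * Real.cos x := by
  have := Real.cos_two_mul (x / 2)
  rw [mul_div_cancel₀ _ two_ne_zero] at this
  rw [g, Real.sin_sq]
  linarith

theorem strictMonoOn_g : StrictMonoOn g (Icc 0 Real.pi) := by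
  intro x hx y hy hxy
  rw [g_eq, g_eq]
  have := Real.strictAntiOn_cos hx hy hxy
  linarith

theorem isHermitian_lap (α : ℝ) (n : ℕ) : (lap α n).IsHermitian := by
  refine Matrix.IsHermitian.ext fun i k => ?_
  simp only [lap, Matrix.of_apply, Fin.ext_iff, star_trivial]
  split_ifs <;> first | rfl | omega

/-- If `ϰ_α < n`, the laplacian matrix has a negative eigenvalue. -/
theorem exists_neg_root {α : ℝ} (hα : α < 0) {n : ℕ} (hn : 3 ≤ n) (hk : kappa α < n) :
    ∃ μ < 0, (lap α n).charpoly.IsRoot μ := by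
  have hH := isHermitian_lap α n
  by_contra! hcon
  have hpsd : (lap α n).PosSemidef := by
    rw [hH.posSemidef_iff_eigenvalues_nonneg]
    intro i
    by_contra hi
    refine hcon _ (not_le.1 hi) (charpoly_isRoot_of_mulVec ?_ (hH.mulVec_eigenvectorBasis i))
    intro h0
    exact hH.eigenvectorBasis.orthonormal.ne_zero i (by ext k; exact congrFun h0 k)
  -- Test vector `(0, 1, ..., n - 1)`: being linear, it is annihilated in the interior rows, and its
  -- first entry is `0`. Only the last row contributes to the quadratic form, with the sign of `1 +
  -- α (n - 1)`, negative exactly when `ϰ < n`.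
  have h1 := hpsd.dotProduct_mulVec_nonneg (fun k => (k.val : ℝ))
  have h2 : ∀ i : Fin n, star (fun k : Fin n => (k.val : ℝ)) i *
      (lap α n).mulVec (fun k => (k.val : ℝ)) i =
      (if i.val = n - 1 then 1 + α * (n - 1) else 0) * (i.val : ℝ) := by
    intro i
    rw [lap_mulVec hn (fun x => x)]
    have hi := i.isLt
    simp only [Pi.star_apply, star_trivial]
    by_cases h0 : i.val = 0
    · simp [h0]
    · by_cases h1 : i.val + 1 = n
      · rw [if_neg h0, if_pos h1, if_pos (by omega)]
        ring
      · rw [if_neg h0, if_neg h1, if_neg (by omega)]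
        ring
  rw [dotProduct, Finset.sum_congr rfl fun i _ => h2 i,
    sum_ite_val_eq (fun m : ℕ => (m : ℝ)), if_pos (by omega)] at h1
  have hn1 : ((n - 1 : ℕ) : ℝ) = n - 1 := by push_cast [Nat.cast_sub (by omega : 1 ≤ n)]; ring
  have hnr : (3 : ℝ) ≤ n := by exact_mod_cast hn
  rw [hn1] at h1
  have h3 : 1 + α * (n - 1) < 0 := by
    rw [kappa, div_lt_iff_of_neg hα] at hk
    linarith
  nlinarith

/-- A solution of the three-term recurrence that satisfies the boundary conditions of the weighted
cycle gives an eigenvector of the laplacian matrix. -/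
theorem isRoot_of_recurrence {α x : ℝ} {n : ℕ} (hn : 3 ≤ n) {f : ℝ → ℝ}
    (hf : ∀ t, f (t - 1) + f (t + 1) = 2 * Real.cos x * f t)
    (hl : f (-1) = (1 - α) * f 0 + α * f (n - 1))
    (hr : f n = (1 - α) * f (n - 1) + α * f 0) (hne : f 0 ≠ 0 ∨ f 1 ≠ 0) :
    (lap α n).charpoly.IsRoot (g x) := by
  refine charpoly_isRoot_of_mulVec (v := fun k => f k) ?_ ?_
  · intro h0
    have e0 := congrFun h0 ⟨0, by omega⟩
    have e1 := congrFun h0 ⟨1, by omega⟩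
    simp only [Nat.cast_zero, Nat.cast_one, Pi.zero_apply] at e0 e1
    exact hne.elim (· e0) (· e1)
  · funext i
    rw [lap_mulVec hn, g_eq, Pi.smul_apply, smul_eq_mul]
    split_ifs with h0 h1
    · have := hf 0
      rw [zero_sub, zero_add] at this
      rw [h0, Nat.cast_zero]
      linarith
    · have := hf (n - 1)
      rw [sub_add_cancel, show (n : ℝ) - 1 - 1 = n - 2 by ring] at this
      have hi : (i.val : ℝ) = n - 1 := by
        have : ((i.val + 1 : ℕ) : ℝ) = n := congrArg _ h1
        push_cast at this
        linarith
      rw [hi]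
      linarith
    · have := hf i
      linarith

theorem isRoot_of_even {α : ℝ} {n i : ℕ} (hn : 3 ≤ n) (hi : Even i) (hin : i < n) :
    (lap α n).charpoly.IsRoot (g (i * Real.pi / n)) := by
  obtain ⟨m, rfl⟩ := hi
  have hn0 : (0 : ℝ) < n := by exact_mod_cast (by omega : 0 < n)
  set x : ℝ := ((m + m : ℕ) : ℝ) * Real.pi / n with hx
  have hnx : n * x = m * (2 * Real.pi) := by rw [hx]; push_cast; field_simp; ring
  have hx0 : 0 ≤ x := by positivity
  have hxpi : x < Real.pi := by
    have : ((m + m : ℕ) : ℝ) < n := by exact_mod_cast hin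
    rw [hx, div_lt_iff₀ hn0]
    nlinarith [Real.pi_pos]
  have hper : ∀ t : ℝ, Real.cos ((n + t) * x) = Real.cos (t * x) := by
    intro t
    rw [show (n + t) * x = t * x + m * (2 * Real.pi) by rw [add_mul, hnx]; ring,
      Real.cos_add_nat_mul_two_pi]
  have h1 := hper (-1 / 2)
  have h2 := hper (1 / 2)
  have h3 : Real.cos (-1 / 2 * x) = Real.cos (1 / 2 * x) := by rw [← Real.cos_neg]; ring_nf
  refine isRoot_of_recurrence hn (f := fun t => Real.cos ((t + 1 / 2) * x)) (fun t => ?_) ?_ ?_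
    (Or.inl ?_)
  · rw [show (t - 1 + 1 / 2) * x = (t + 1 / 2) * x - x by ring,
      show (t + 1 + 1 / 2) * x = (t + 1 / 2) * x + x by ring, Real.cos_sub, Real.cos_add]
    ring
  · rw [show (n : ℝ) - 1 + 1 / 2 = n + -1 / 2 by ring, h1, zero_add,
      show (-1 : ℝ) + 1 / 2 = -1 / 2 by ring, h3]
    ring
  · rw [show (n : ℝ) - 1 + 1 / 2 = n + -1 / 2 by ring, h1, h2, zero_add, h3]
    ring
  · exact (Real.cos_pos_of_mem_Ioo ⟨by linarith [Real.pi_pos], by linarith⟩).ne'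

theorem isRoot_of_h_eq_zero {α : ℝ} (hα : α < 0) {n j : ℕ} (hn : 3 ≤ n) (hj : Even j) {x : ℝ}
    (hx : x ∈ Ioo 0 Real.pi) (h0 : h α n j x = 0) :
    (lap α n).charpoly.IsRoot (g x) := by
  obtain ⟨m, rfl⟩ := hj
  have hc := cos_half_pos hx
  set θ := Real.arctan (kappa α * Real.tan (x / 2)) with hθ
  have hcθ : 0 < Real.cos θ := Real.cos_arctan_pos _
  have htan : Real.sin θ * Real.cos (x / 2) = kappa α * Real.sin (x / 2) * Real.cos θ := by
    have := Real.tan_arctan (kappa α * Real.tan (x / 2))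
    rw [← hθ, Real.tan_eq_sin_div_cos, Real.tan_eq_sin_div_cos] at this
    field_simp at this
    linarith
  -- Evenness of `j` matters here: half of the multiple of `π` in `h = 0` is again an integer
  -- multiple.
  have hang : n * x / 2 - θ = ((m - 1 : ℤ) : ℝ) * Real.pi := by
    rw [h, eta, if_neg hx.2.ne] at h0
    push_cast at h0 ⊢
    linarith
  have hsin : Real.sin (n * x / 2) * Real.cos θ = Real.cos (n * x / 2) * Real.sin θ := by
    have := Real.sin_int_mul_pi (m - 1)
    rw [← hang, Real.sin_sub] at this
    linarith
  have hkey : Real.sin (n * x / 2) * Real.cos (x / 2) =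
      kappa α * (Real.cos (n * x / 2) * Real.sin (x / 2)) := by
    refine mul_right_cancel₀ hcθ.ne' ?_
    linear_combination Real.cos (x / 2) * hsin + Real.cos (n * x / 2) * htan
  have hακ : α * kappa α = α - 1 := mul_div_cancel₀ _ hα.ne
  -- By antisymmetry, both boundary conditions reduce to this one.
  have hbd : Real.sin (n * x / 2 + x / 2) = (1 - 2 * α) * Real.sin (n * x / 2 - x / 2) := by
    rw [Real.sin_add, Real.sin_sub]
    linear_combination 2 * α * hkey + 2 * (Real.cos (n * x / 2) * Real.sin (x / 2)) * hακ
  refine isRoot_of_recurrence hn (f := fun t => Real.sin ((t + 1 / 2 - n / 2) * x))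
    (fun t => ?_) ?_ ?_ ?_
  · rw [show (t - 1 + 1 / 2 - n / 2) * x = (t + 1 / 2 - n / 2) * x - x by ring,
      show (t + 1 + 1 / 2 - n / 2) * x = (t + 1 / 2 - n / 2) * x + x by ring,
      Real.sin_sub, Real.sin_add]
    ring
  · rw [show (-1 + 1 / 2 - (n : ℝ) / 2) * x = -(n * x / 2 + x / 2) by ring,
      show (0 + 1 / 2 - (n : ℝ) / 2) * x = -(n * x / 2 - x / 2) by ring,
      show ((n : ℝ) - 1 + 1 / 2 - n / 2) * x = n * x / 2 - x / 2 by ring,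
      Real.sin_neg, Real.sin_neg, hbd]
    ring
  · rw [show ((n : ℝ) + 1 / 2 - n / 2) * x = n * x / 2 + x / 2 by ring,
      show (0 + 1 / 2 - (n : ℝ) / 2) * x = -(n * x / 2 - x / 2) by ring,
      show ((n : ℝ) - 1 + 1 / 2 - n / 2) * x = n * x / 2 - x / 2 by ring,
      Real.sin_neg, hbd]
    ring
  · by_contra! hz
    obtain ⟨hz0, hz1⟩ := hz
    rw [show (1 + 1 / 2 - (n : ℝ) / 2) * x = (0 + 1 / 2 - n / 2) * x + x by ring,
      Real.sin_add, hz0, zero_mul, zero_add] at hz1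
    have hsx : Real.sin x ≠ 0 := (Real.sin_pos_of_mem_Ioo hx).ne'
    have hcz := (mul_eq_zero.1 hz1).resolve_right hsx
    have := Real.sin_sq_add_cos_sq ((0 + 1 / 2 - (n : ℝ) / 2) * x)
    rw [hz0, hcz] at this
    norm_num at this

end Spectrum

end CycleLaplacian

namespace CycleLaplacian

/-! ### Identification of the sorted spectrum -/

section Eigenvalues

/-- As many distinct roots as the degree exhaust the root multiset, so all are simple. -/
theorem sort_roots_eq_ofFn {n : ℕ} {p : Polynomial ℝ} (hp : p ≠ 0) (hn : p.natDegree = n)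
    {μ : Fin n → ℝ} (hμ : StrictMono μ) (hroot : ∀ i, p.IsRoot (μ i)) :
    p.roots.sort (· ≤ ·) = List.ofFn μ := by
  have hle : ((List.ofFn μ : List ℝ) : Multiset ℝ) ≤ p.roots := by
    rw [Multiset.le_iff_subset (Multiset.coe_nodup.2 (List.nodup_ofFn.2 hμ.injective))]
    intro a ha
    obtain ⟨i, rfl⟩ := (List.mem_ofFn' _ _).1 (Multiset.mem_coe.1 ha)
    exact (Polynomial.mem_roots hp).2 (hroot i)
  have heq := Multiset.eq_of_le_of_card_le hle (by simpa [hn] using p.card_roots')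
  rw [← heq, Multiset.coe_sort]
  exact List.mergeSort_eq_self _ (List.pairwise_ofFn.2 fun i j hij => (hμ hij).le)

/-- For even `j ≥ 4`, the `j`-th eigenvalue is the value of the symbol at the zero of `h`. -/
theorem exists_zero_eigval {α : ℝ} (hα : α < 0) {n j : ℕ} (hn : N α ≤ n) (hj : Even j)
    (hj4 : 4 ≤ j) (hjn : j ≤ n) :
    ∃ x ∈ Ioo (d n (j - 1)) (d n j), h α n j x = 0 ∧ g x = eigval α n j := by
  have hn3 : 3 ≤ n := (le_max_left _ _).trans hn
  have hn0 : (0 : ℝ) < n := by exact_mod_cast (by omega : 0 < n)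
  have hpi := Real.pi_pos
  obtain ⟨ν, hν0, hνr⟩ := exists_neg_root hα hn3 (kappa_lt_of_N_le hn)
  -- Here `i` is the position in the sorted list counted from `0`; position `0` is left for `ν`.
  -- Apart from `x = 0` at `i = 1`, the points lie in the disjoint intervals `((i - 1)π/n, iπ/n]`,
  -- which gives the ordering.
  have hex : ∀ i, 1 ≤ i → i < n → ∃ x ∈ Icc 0 Real.pi,
      (2 ≤ i → ((i : ℝ) - 1) * Real.pi / n < x) ∧ x ≤ i * Real.pi / n ∧
      (lap α n).charpoly.IsRoot (g x) ∧ (Odd i → 3 ≤ i → h α n (i + 1) x = 0) := by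
    intro i hi hin
    have hir : (i : ℝ) < n := by exact_mod_cast hin
    have hi1 : (1 : ℝ) ≤ i := by exact_mod_cast hi
    have hipi : (i : ℝ) * Real.pi / n ≤ Real.pi := by
      rw [div_le_iff₀ hn0]
      nlinarith
    rcases Nat.even_or_odd i with he | ho
    · have hlt : ((i : ℝ) - 1) * Real.pi / n < i * Real.pi / n := by gcongr; linarith
      exact ⟨i * Real.pi / n, ⟨by positivity, hipi⟩, fun _ => hlt, le_rfl,
        isRoot_of_even hn3 he hin, fun ho => absurd he (Nat.not_even_iff_odd.2 ho)⟩
    · rcases Nat.lt_or_ge i 3 with h3 | h3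
      · obtain rfl : i = 1 := by obtain ⟨k, rfl⟩ := ho; omega
        refine ⟨0, ⟨le_rfl, hpi.le⟩, fun h => absurd h (by norm_num), by positivity, ?_,
          fun _ h => absurd h (by norm_num)⟩
        simpa using isRoot_of_even (α := α) hn3 Even.zero (by omega : 0 < n)
      · obtain ⟨x, hx, hx0⟩ := exists_h_eq_zero hα (n := n) (j := i + 1) (by omega) (by omega)
        have hd0 : d n (i + 1 - 1) = ((i : ℝ) - 1) * Real.pi / n := by
          rw [Nat.add_sub_cancel, d]
        have hd1 : d n (i + 1) = (i : ℝ) * Real.pi / n := by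
          rw [d]; push_cast; ring
        rw [hd0, hd1] at hx
        have hi3 : (0 : ℝ) < i - 1 := by
          have : (3 : ℝ) ≤ i := by exact_mod_cast h3
          linarith
        have hxpos : 0 < x := lt_trans (by positivity) hx.1
        have hxpi : x < Real.pi := hx.2.trans_le hipi
        exact ⟨x, ⟨hxpos.le, hxpi.le⟩, fun _ => hx.1, hx.2.le,
          isRoot_of_h_eq_zero hα hn3 (by obtain ⟨k, rfl⟩ := ho; exact ⟨k + 1, by ring⟩)
            ⟨hxpos, hxpi⟩ hx0, fun _ _ => hx0⟩
  choose! x hxm hxlt hxhi hxr hxh using hex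
  set μ : Fin n → ℝ := fun i => if i.val = 0 then ν else g (x i.val) with hμ
  have hmono : StrictMono μ := by
    intro i k hik
    have hik' : i.val < k.val := hik
    have hk0 : k.val ≠ 0 := by omega
    simp only [hμ, if_neg hk0]
    split_ifs with hi0
    · exact hν0.trans_le (by unfold g; positivity)
    · refine strictMonoOn_g (hxm _ (by omega) i.isLt) (hxm _ (by omega) k.isLt) ?_
      refine (hxhi _ (by omega) i.isLt).trans_lt (lt_of_le_of_lt ?_
        (hxlt k (by omega) k.isLt (by omega)))
      have : (i.val : ℝ) + 1 ≤ k.val := by exact_mod_cast hik'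
      gcongr
      linarith
  have hroot : ∀ i, (lap α n).charpoly.IsRoot (μ i) := by
    intro i
    simp only [hμ]
    split_ifs with hi0
    · exact hνr
    · exact hxr _ (by omega) i.isLt
  have hsort := sort_roots_eq_ofFn (lap α n).charpoly_monic.ne_zero
    (by simp [Matrix.charpoly_natDegree_eq_dim]) hmono hroot
  have hj1 : j - 1 < n := by omega
  have hcast : ((j - 1 : ℕ) : ℝ) = j - 1 := by push_cast [Nat.cast_sub (by omega : 1 ≤ j)]; ring
  have hjj : j - 1 + 1 = j := by omega
  have hodd : Odd (j - 1) := by obtain ⟨k, rfl⟩ := hj; exact ⟨k - 1, by omega⟩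
  have hh := hxh (j - 1) (by omega) hj1 hodd (by omega)
  rw [hjj] at hh
  have hge : g (x (j - 1)) = eigval α n j := by
    rw [eigval, hsort, List.getD_eq_getElem _ _ (by simpa using hj1), List.getElem_ofFn]
    simp only [hμ]
    rw [if_neg (by omega)]
  have hlo := hxlt (j - 1) (by omega) hj1 (by omega)
  have hhi := hxhi (j - 1) (by omega) hj1
  refine ⟨x (j - 1), ⟨hlo, lt_of_le_of_ne (by rw [d, ← hcast]; exact hhi) ?_⟩, hh, hge⟩
  -- The right end is excluded because `h` equals `-η > 0` there.
  intro hxd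
  have hdm : d n j ∈ Ioo 0 Real.pi := by
    have hjr : (4 : ℝ) ≤ j := by exact_mod_cast hj4
    have hjnr : (j : ℝ) ≤ n := by exact_mod_cast hjn
    have h3 : (0 : ℝ) < j - 1 := by linarith
    refine ⟨by unfold d; positivity, ?_⟩
    rw [d, div_lt_iff₀ hn0]
    nlinarith
  have heta := (eta_mem_Ioo hα hdm).2
  rw [hxd, h, show (n : ℝ) * d n j = (j - 1) * Real.pi by unfold d; field_simp] at hh
  linarith

end Eigenvalues

end CycleLaplacian

/-! ### Newton's method applied to `h` -/

theorem mainTheorem8 (α : ℝ) (hα : α < 0) (n j : ℕ) (hn : CycleLaplacian.N α ≤ n)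
    (hj : Even j) (hj4 : 4 ≤ j) (hjn : j ≤ n) :
    -- the point `z` is well defined
    (CycleLaplacian.z α n j ∈ Icc 0 Real.pi ∧
      CycleLaplacian.g (CycleLaplacian.z α n j) = CycleLaplacian.eigval α n j) ∧
    -- the Newton sequence is well defined
    (∀ m : ℕ,
      CycleLaplacian.y α n j m ∈ Icc (CycleLaplacian.d n (j - 1)) (CycleLaplacian.d n j) ∧
      DifferentiableAt ℝ (CycleLaplacian.h α n j) (CycleLaplacian.y α n j m) ∧
      deriv (CycleLaplacian.h α n j) (CycleLaplacian.y α n j m) ≠ 0) ∧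
    -- it converges
    Tendsto (CycleLaplacian.y α n j) atTop (𝓝 (CycleLaplacian.z α n j)) ∧
    -- the convergence is at least linear
    (∃ r : ℝ, r < 1 ∧ ∀ m : ℕ,
      |CycleLaplacian.y α n j (m + 1) - CycleLaplacian.z α n j| ≤
        r * |CycleLaplacian.y α n j m - CycleLaplacian.z α n j|) ∧
    (∀ m : ℕ, |CycleLaplacian.y α n j m - CycleLaplacian.z α n j| ≤
      Real.pi / n *
        ((CycleLaplacian.kappa α ^ 2 - 1) / (CycleLaplacian.kappa α * n - 1)) ^ m) ∧
    -- for large `n` the convergence is quadratic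
    (2 * CycleLaplacian.N α ≤ n →
      (∃ C : ℝ, ∀ m : ℕ,
        |CycleLaplacian.y α n j (m + 1) - CycleLaplacian.z α n j| ≤
          C * |CycleLaplacian.y α n j m - CycleLaplacian.z α n j| ^ 2) ∧
      (∀ m : ℕ, |CycleLaplacian.y α n j m - CycleLaplacian.z α n j| ≤
        Real.pi / n *
          (Real.pi * CycleLaplacian.kappa α ^ 2 / (2 * (n : ℝ) ^ 2)) ^ (2 ^ m - 1))) := by
  open CycleLaplacian in
  obtain ⟨x, hxd, hx0, hxg⟩ := exists_zero_eigval hα hn hj hj4 hjn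
  have hn0 : (0 : ℝ) < n := by exact_mod_cast (by omega : 0 < n)
  have hpi := Real.pi_pos
  have hjr : (4 : ℝ) ≤ j := by exact_mod_cast hj4
  have hjnr : (j : ℝ) ≤ n := by exact_mod_cast hjn
  have hk := one_lt_kappa hα
  have hkn := kappa_lt_of_N_le hn
  set k := kappa α with hkdef
  have hd0 : 0 < d n (j - 1) := by
    have h3 : (0 : ℝ) < ((j - 1 : ℕ) : ℝ) - 1 := by
      push_cast [Nat.cast_sub (by omega : 1 ≤ j)]
      linarith
    unfold d
    positivity
  have hd1 : d n j < Real.pi := by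
    rw [d, div_lt_iff₀ hn0]
    nlinarith
  have hdd : d n j - d n (j - 1) = Real.pi / n := by
    unfold d
    push_cast [Nat.cast_sub (by omega : 1 ≤ j)]
    ring
  have hmem : ∀ t ∈ Icc x (d n j), t ∈ Ioo 0 Real.pi :=
    fun t ht => ⟨(hd0.trans hxd.1).trans_le ht.1, ht.2.trans_lt hd1⟩
  have hz : z α n j = x := by
    rw [z, ← hxg]
    exact strictMonoOn_g.injOn.leftInvOn_invFunOn
      (Ioo_subset_Icc_self (hmem x ⟨le_rfl, hxd.2.le⟩))
  have hf : ∀ t ∈ Icc x (d n j), HasDerivAt (h α n j) (n - etaDeriv k t) t :=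
    fun t ht => hasDerivAt_h hα n j (hmem t ht)
  have hmono : MonotoneOn (fun t => n - etaDeriv k t) (Icc x (d n j)) := by
    intro s hs t ht hst
    have := antitoneOn_etaDeriv hk (Ioo_subset_Icc_self (hmem s hs))
      (Ioo_subset_Icc_self (hmem t ht)) hst
    simp only
    linarith
  have hlo : ∀ t ∈ Icc x (d n j), n - k ≤ n - etaDeriv k t :=
    fun t _ => by linarith [etaDeriv_le hk t]
  have hhi : ∀ t ∈ Icc x (d n j), n - etaDeriv k t ≤ n - 1 / k :=
    fun t _ => by linarith [one_div_le_etaDeriv hk t]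
  have hlo0 : 0 < n - k := by linarith
  have hy : ∀ m, y α n j m ∈ Icc x (d n j) := fun m =>
    newton_mem_Icc hf hx0 hxd.2.le hmono (fun t ht => hlo0.trans_le (hlo t ht)) m
  have habs : ∀ m, |y α n j m - z α n j| = y α n j m - x := fun m => by
    rw [hz, abs_of_nonneg (sub_nonneg.2 (hy m).1)]
  have he0 : y α n j 0 - x ≤ Real.pi / n := by
    have := hxd.1
    have h0 : y α n j 0 = d n j := rfl
    rw [h0]
    linarith
  have hden : 0 < k * n - 1 := by nlinarith
  -- The rate `1 - lo / hi` with `lo = n - k` and `hi = n - 1 / k`.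
  have hr : 1 - (n - k) / (n - 1 / k) = (k ^ 2 - 1) / (k * n - 1) := by
    have h1 : n - 1 / k = (k * n - 1) / k := by field_simp
    rw [h1, div_div_eq_mul_div, eq_div_iff hden.ne', sub_mul, div_mul_cancel₀ _ hden.ne']
    ring
  have hr0 : 0 ≤ (k ^ 2 - 1) / (k * n - 1) := div_nonneg (by nlinarith) hden.le
  have hr1 : (k ^ 2 - 1) / (k * n - 1) < 1 := by
    rw [div_lt_one hden]
    nlinarith
  have hlin : ∀ m, y α n j (m + 1) - x ≤ (k ^ 2 - 1) / (k * n - 1) * (y α n j m - x) :=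
    fun m => by
      rw [← hr]
      exact newton_succ_sub_le_linear hf hx0 hxd.2.le hmono hlo0 hlo hhi m
  have hlin' := le_mul_pow_of_succ_le (e := fun m => y α n j m - x) he0 hr0 hlin
  refine ⟨⟨?_, ?_⟩, fun m => ⟨⟨hxd.1.le.trans (hy m).1, (hy m).2⟩,
    (hf _ (hy m)).differentiableAt, ?_⟩, ?_, ⟨_, hr1, fun m => ?_⟩, fun m => ?_, fun hn2 => ?_⟩
  · rw [hz]
    exact Ioo_subset_Icc_self (hmem x ⟨le_rfl, hxd.2.le⟩)
  · rw [hz, hxg]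
  · rw [(hf _ (hy m)).deriv]
    exact (hlo0.trans_le (hlo _ (hy m))).ne'
  · have ht : Tendsto (fun m => Real.pi / n * ((k ^ 2 - 1) / (k * n - 1)) ^ m) atTop (𝓝 0) := by
      simpa using (tendsto_pow_atTop_nhds_zero_of_lt_one hr0 hr1).const_mul (Real.pi / n)
    have h1 := squeeze_zero (fun m => sub_nonneg.2 (hy m).1) hlin' ht
    rw [hz]
    simpa using h1.add_const x
  · rw [habs, habs]
    exact hlin m
  · rw [habs]
    exact hlin' m
  -- Applying the bound on `ϰ` to the order `⌊n/2⌋ ≥ N α` gives `ϰ < n / 2`.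
  · have hkn2 : n / 2 ≤ n - k := by
      have h1 : N α ≤ n / 2 := by omega
      have h2 := kappa_lt_of_N_le h1
      have h3 : ((n / 2 : ℕ) : ℝ) ≤ n / 2 := Nat.cast_div_le
      linarith
    have hquad : ∀ m, y α n j (m + 1) - x ≤
        k ^ 2 / (2 * n) * (y α n j m - x) ^ 2 := by
      intro m
      have := newton_succ_sub_le_quadratic (lo := n / 2) (K := k ^ 2 / 2) hf hx0 hxd.2.le hmono
        (by positivity) (fun t ht => hkn2.trans (hlo t ht)) (by positivity)
        (fun s _ t _ hst => by linarith [etaDeriv_sub_le hk hst]) m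
      rwa [show k ^ 2 / 2 / (2 * ((n : ℝ) / 2)) = k ^ 2 / (2 * n) by field_simp] at this
    refine ⟨⟨k ^ 2 / (2 * n), fun m => ?_⟩, fun m => ?_⟩
    · rw [habs, habs]
      exact hquad m
    · rw [habs]
      -- The base is the quadratic constant `k² / (2n)` times the initial error bound `π / n`.
      refine le_mul_pow_two_pow_of_succ_le (e := fun m => y α n j m - x)
        (fun m => sub_nonneg.2 (hy m).1) he0 (by positivity) (le_of_eq ?_) hquad m
      field_simp
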